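/- Let $N>1$ be an integer and let $m,r_0>0$. Put $$f(r,d)=\sum_{k=1}^{2N-1}\frac{\sin^2(k\pi/2N)}{\left[4r^2\sin^2(k\pi/2N)+((-1)^k-1)^2d^2\right]^{3/2}},\qquad g(r,d)=\sum_{k=1}^{2N-1}\frac{((-1)^k-1)^2}{\left[4r^2\sin^2(k\pi/2N)+((-1)^k-1)^2d^2\right]^{3/2}},$$ $$\alpha_N=\frac1{16}\sum_{k=1}^{2N-1}\frac{((-1)^k-1)^2}{\sin^3(k\pi/2N)},\qquad \gamma_N=\frac14\sum_{k=1}^{2N-1}\frac1{\sin(k\pi/2N)}.$$ For real $a,b$, let $r(t)=R(a,b,t)>0$ and $d(t)=D(a,b,t)$ denote the solution of the reduced antiprism $2N$-body problem $$\ddot r=\frac{a^2}{r^3}-2rm\,f(r,d),\qquad \ddot d=-\frac{m\,d}{2}\,g(r,d),\qquad r(0)=r_0,\quad \dot r(0)=0,\quad d(0)=0,\quad \dot d(0)=b.$$ Then there exist $\hat b>0$ and continuously differentiable functions $T,a:(-\hat b,\hat b)\to\mathbb R$ with $$T(0)=\pi\sqrt{\frac{r_0^3}{m\alpha_N}},\qquad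 a(0)=\sqrt{m\gamma_N r_0},$$ such that for every $b\in(-\hat b,\hat b)$ the solution $R(a(b),b,\cdot)$, $D(a(b),b,\cdot)$ exists for all times and is unique, both functions are $2T(b)$-periodic, and $(a(b),b,T(b))$ solves the system (II), that is, $T(b)>0$, $$R_t(a(b),b,T(b))=0\quad\text{and}\quad D(a(b),b,T(b))=0.$$ -/

import Mathlib

noncomputable section

namespace HipHop

/-- The sum `f(r, d)` in the radial equation of motion of the antiprism `2N`-body problem. -/
def f (N : ℕ) (r d : ℝ) : ℝ :=
  ∑ k ∈ Finset.Icc 1 (2 * N - 1),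
    Real.sin (k * Real.pi / (2 * N)) ^ 2 /
      (4 * r ^ 2 * Real.sin (k * Real.pi / (2 * N)) ^ 2
        + ((-1) ^ k - 1) ^ 2 * d ^ 2) ^ (3 / 2 : ℝ)

/-- The sum `g(r, d)` in the vertical equation of motion of the antiprism `2N`-body problem. -/
def g (N : ℕ) (r d : ℝ) : ℝ :=
  ∑ k ∈ Finset.Icc 1 (2 * N - 1),
    ((-1) ^ k - 1) ^ 2 /
      (4 * r ^ 2 * Real.sin (k * Real.pi / (2 * N)) ^ 2
        + ((-1) ^ k - 1) ^ 2 * d ^ 2) ^ (3 / 2 : ℝ)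

/-- The right-hand side `F(a, r, d) = a² / r³ - 2 r m f(r, d)` of the radial equation. -/
def F (N : ℕ) (m a r d : ℝ) : ℝ := a ^ 2 / r ^ 3 - 2 * r * m * f N r d

/-- The right-hand side `G(r, d) = -(m d / 2) g(r, d)` of the vertical equation. -/
def G (N : ℕ) (m r d : ℝ) : ℝ := -(m * d / 2) * g N r d

/-- `α_N = (1/16) ∑_{k=1}^{2N-1} ((-1)^k - 1)² / sin³(kπ/(2N))`. -/
def alpha (N : ℕ) : ℝ :=
  1 / 16 * ∑ k ∈ Finset.Icc 1 (2 * N - 1),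
    ((-1) ^ k - 1) ^ 2 / Real.sin (k * Real.pi / (2 * N)) ^ 3

/-- `γ_N = (1/4) ∑_{k=1}^{2N-1} 1 / sin(kπ/(2N))`. -/
def gamma (N : ℕ) : ℝ :=
  1 / 4 * ∑ k ∈ Finset.Icc 1 (2 * N - 1), 1 / Real.sin (k * Real.pi / (2 * N))

/-- `r = R(a, b, ·)` and `d = D(a, b, ·)` form a solution, defined for all times, of the reduced
initial value problem with angular momentum `a` and initial vertical velocity `b`.
The radius `r` is a distance to the axis that does not vanish. -/
structure IsSolution (N : ℕ) (m r₀ a b : ℝ) (r d : ℝ → ℝ) : Prop where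
  pos : ∀ t, 0 < r t
  differentiable_r : Differentiable ℝ r
  differentiable_d : Differentiable ℝ d
  eq_r : ∀ t, HasDerivAt (deriv r) (F N m a (r t) (d t)) t
  eq_d : ∀ t, HasDerivAt (deriv d) (G N m (r t) (d t)) t
  r_zero : r 0 = r₀
  deriv_r_zero : deriv r 0 = 0
  d_zero : d 0 = 0
  deriv_d_zero : deriv d 0 = b

/-- The system (II): `R_t = 0` and `D = 0` at the positive time `T`. -/
def SystemII (r d : ℝ → ℝ) (T : ℝ) : Prop := 0 < T ∧ deriv r T = 0 ∧ d T = 0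

end HipHop

end

/-!
Inserting `d = b u` and rescaling time to `s = t / T ∈ [0, 1]` turns the conditions `r' = 0`,
`d = 0` at time `T` into a boundary value problem for `(r, u)` with unknown parameters `a` and `T`,
which makes sense also at `b = 0`: there it is solved by the circular motion `r = r₀`,
`a = √(m γ_N r₀)`, with `u` a half period of the linearized vertical oscillation `u'' = -ω² u`,
`ω² = m α_N / r₀³`. The division by `b` removes the trivial planar branch `d = 0`.

Written with the kernels of the oscillators `r'' + μ² r` and `u'' + π² u`, where `μ = π ν / ω` and
`ν² = m γ_N / r₀³` is the squared radial frequency at fixed angular momentum, the problem becomes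
an equation `bvpMap (b, (r, u, a, T)) = 0` in the Banach space `C([0, 1])² × ℝ²`
(superposition operators on `C([0, 1])` are `C¹` by `ContinuousMap.contDiff_comp_left`). This choice
of kernels makes the derivative in the unknowns triangular at the circular solution: its diagonal
consists of two identities, a nonzero multiple of `sin μ`, and the resonant response of
`u'' + π² u` to a change of the period. Hence it is invertible (`isInvertible_fderiv_bvpMap`) as
soon as `sin μ ≠ 0`, and this follows from `0 < γ_N < α_N` (`gamma_lt_alpha`). The implicit function
theorem gives `C¹` functions `T` and `a` of `b` (`exists_isArc_family`).

The equations are invariant under time reversal, also combined with `d ↦ -d`, so a solution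
on `[0, T]` with `r' = 0` and `d = 0` at both ends extends to a `2T`-periodic solution on `ℝ` by
reflections at the multiples of `T`, `r` being even and `d` odd about each of them
(`IsArc.exists_isSolution`). Uniqueness (`IsSolution.unique`) holds because the forces are `C¹` where
`r > 0`.
-/

noncomputable section

/-! ### Superposition operators on spaces of continuous functions -/

namespace ContinuousMap

open scoped Topology

variable {X V W : Type*} [TopologicalSpace X] [CompactSpace X]
  [NormedAddCommGroup V] [NormedSpace ℝ V] [NormedAddCommGroup W] [NormedSpace ℝ W]

/-- Pointwise application of an operator-valued function to a vector-valued function, as a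
continuous bilinear map. -/
def pointwiseApply : C(X, V →L[ℝ] W) →L[ℝ] C(X, V) →L[ℝ] C(X, W) :=
  LinearMap.mkContinuous₂
    (LinearMap.mk₂ ℝ (fun (A : C(X, V →L[ℝ] W)) (h : C(X, V)) =>
        (⟨fun x => A x (h x), by fun_prop⟩ : C(X, W)))
      (fun _ _ _ => by ext; simp) (fun _ _ _ => by ext; simp)
      (fun _ _ _ => by ext; simp) (fun _ _ _ => by ext; simp))
    1 (fun A h => by
      rw [one_mul]
      refine (ContinuousMap.norm_le _ (by positivity)).2 fun x => ?_
      exact (A x).le_of_opNorm_le_of_le (A.norm_coe_le_norm x) (h.norm_coe_le_norm x))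

@[simp]
lemma pointwiseApply_apply (A : C(X, V →L[ℝ] W)) (h : C(X, V)) (x : X) :
    pointwiseApply A h x = A x (h x) := rfl

/-- The superposition operator `f ↦ φ ∘ f` is differentiable, with derivative
`h ↦ (x ↦ φ'(f x) (h x))`. The remainder is controlled by the mean value inequality and the
uniform continuity of `φ'` along the compact range of `f`. -/
lemma hasFDerivAt_comp_left (φ : C(V, W)) (φ' : C(V, V →L[ℝ] W))
    (hφ : ∀ v, HasFDerivAt φ (φ' v) v) (f : C(X, V)) :
    HasFDerivAt (fun f : C(X, V) => φ.comp f) (pointwiseApply (φ'.comp f)) f := by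
  rw [hasFDerivAt_iff_isLittleO_nhds_zero, Asymptotics.isLittleO_iff]
  intro ε hε
  have hcont : Continuous fun g : C(X, V) => φ'.comp g := ContinuousMap.continuous_postcomp φ'
  obtain ⟨δ, hδ, hball⟩ := (Metric.continuousAt_iff (α := C(X, V))
    (β := C(X, V →L[ℝ] W))).1 (hcont.continuousAt (x := f)) ε hε
  filter_upwards [Metric.ball_mem_nhds (0 : C(X, V)) hδ] with h hh
  rw [mem_ball_zero_iff] at hh
  rw [ContinuousMap.norm_le _ (by positivity)]
  intro x
  have key : ∀ y ∈ segment ℝ (f x) (f x + h x), ‖φ' y - φ' (f x)‖ ≤ ε := by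
    rintro y hy
    rw [segment_eq_image'] at hy
    obtain ⟨t, ⟨ht0, ht1⟩, rfl⟩ := hy
    have hd : dist (f + t • h) f < δ := by
      rw [dist_eq_norm, add_sub_cancel_left, norm_smul, Real.norm_of_nonneg ht0]
      nlinarith [norm_nonneg h]
    have := (ContinuousMap.dist_apply_le_dist (f := φ'.comp (f + t • h)) (g := φ'.comp f) x).trans
      (hball hd).le
    simpa [dist_eq_norm] using this
  have := (convex_segment (𝕜 := ℝ) (f x) (f x + h x)).norm_image_sub_le_of_norm_hasFDerivWithin_le'
    (fun y _ => (hφ y).hasFDerivWithinAt) key (left_mem_segment ℝ _ _) (right_mem_segment ℝ _ _)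
  simp only [add_sub_cancel_left] at this
  calc _ = ‖φ (f x + h x) - φ (f x) - φ' (f x) (h x)‖ := by simp
    _ ≤ ε * ‖h x‖ := this
    _ ≤ ε * ‖h‖ := by gcongr; exact h.norm_coe_le_norm x

lemma contDiff_comp_left (φ : C(V, W)) (hφ : ContDiff ℝ 1 φ) :
    ContDiff ℝ 1 (fun f : C(X, V) => φ.comp f) := by
  obtain ⟨φ', hc, h⟩ := contDiff_one_iff_hasFDerivAt.1 hφ
  refine contDiff_one_iff_hasFDerivAt.2
    ⟨fun f => pointwiseApply ((⟨φ', hc⟩ : C(V, V →L[ℝ] W)).comp f), ?_,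
      fun f => hasFDerivAt_comp_left φ ⟨φ', hc⟩ h f⟩
  exact pointwiseApply.continuous.comp (ContinuousMap.continuous_postcomp _)

end ContinuousMap

/-! ### The forced harmonic oscillator on the unit interval -/

namespace HipHop

open unitInterval

/-- The primitive `t ↦ ∫₀ᵗ w` of a continuous function on `[0, 1]`, as a function on `ℝ`; outside
`[0, 1]` the integrand is extended by its boundary values. -/
def primitive (w : C(I, ℝ)) (t : ℝ) : ℝ := ∫ τ in (0 : ℝ)..t, Set.IccExtend zero_le_one w τ

lemma hasDerivAt_primitive (w : C(I, ℝ)) {t : ℝ} (ht : t ∈ I) :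
    HasDerivAt (primitive w) (w ⟨t, ht⟩) t := by
  have hc : Continuous (Set.IccExtend (zero_le_one' ℝ) w) := w.continuous.Icc_extend'
  have := hc.integral_hasStrictDerivAt 0 t
  rw [Set.IccExtend_of_mem _ _ ht] at this
  exact this.hasDerivAt

lemma continuous_primitive (w : C(I, ℝ)) : Continuous (primitive w) :=
  intervalIntegral.continuous_primitive
    (fun _ _ => (w.continuous.Icc_extend' (h := zero_le_one' ℝ)).intervalIntegrable _ _) 0

@[simp] lemma primitive_zero (w : C(I, ℝ)) : primitive w 0 = 0 := by simp [primitive]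

lemma primitive_eq_integral (w : C(I, ℝ)) {k : ℝ → ℝ} (hk : ∀ s : I, w s = k s) :
    primitive w 1 = ∫ τ in (0 : ℝ)..1, k τ := by
  refine intervalIntegral.integral_congr fun τ hτ => ?_
  rw [Set.uIcc_of_le zero_le_one] at hτ
  simp only [Set.IccExtend_of_mem _ _ hτ, hk]

/-- `HipHop.primitive` as a bounded operator on `C([0, 1])`. -/
def primitiveCLM : C(I, ℝ) →L[ℝ] C(I, ℝ) :=
  LinearMap.mkContinuous
    { toFun := fun w => ⟨fun s => primitive w s, (continuous_primitive w).comp continuous_subtype_val⟩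
      map_add' := fun v w => by
        ext s
        exact intervalIntegral.integral_add
          ((v.continuous.Icc_extend' (h := zero_le_one' ℝ)).intervalIntegrable _ _)
          ((w.continuous.Icc_extend' (h := zero_le_one' ℝ)).intervalIntegrable _ _)
      map_smul' := fun c w => by
        ext s
        exact intervalIntegral.integral_const_mul c _ }
    1 (fun w => by
      rw [one_mul]
      refine (ContinuousMap.norm_le _ (by positivity)).2 fun s => ?_
      have := intervalIntegral.norm_integral_le_of_norm_le_const (a := 0) (b := (s : ℝ))
        (f := Set.IccExtend (zero_le_one' ℝ) w) (C := ‖w‖) fun _ _ => w.norm_coe_le_norm _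
      refine this.trans ?_
      rw [sub_zero, abs_of_nonneg s.2.1]
      exact mul_le_of_le_one_right (norm_nonneg _) s.2.2)

@[simp] lemma primitiveCLM_apply (w : C(I, ℝ)) (s : I) : primitiveCLM w s = primitive w s := rfl

/-- `s ↦ sin (ω s)` on `[0, 1]`. -/
def sinOn (ω : ℝ) : C(I, ℝ) := ⟨fun s => Real.sin (ω * s), by fun_prop⟩

/-- `s ↦ cos (ω s)` on `[0, 1]`. -/
def cosOn (ω : ℝ) : C(I, ℝ) := ⟨fun s => Real.cos (ω * s), by fun_prop⟩

@[simp] lemma sinOn_apply (ω : ℝ) (s : I) : sinOn ω s = Real.sin (ω * s) := rfl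
@[simp] lemma cosOn_apply (ω : ℝ) (s : I) : cosOn ω s = Real.cos (ω * s) := rfl

/-- The solution `∫₀ᵗ sin (ω (t - τ)) / ω * w τ dτ` of `y'' + ω² y = w`, `y 0 = y' 0 = 0`, written
with the addition theorem so that only primitives occur. -/
def sineResponse (ω : ℝ) (w : C(I, ℝ)) (t : ℝ) : ℝ :=
  ω⁻¹ * (Real.sin (ω * t) * primitive (cosOn ω * w) t
    - Real.cos (ω * t) * primitive (sinOn ω * w) t)

/-- The derivative `∫₀ᵗ cos (ω (t - τ)) * w τ dτ` of `HipHop.sineResponse ω w`. -/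
def cosineResponse (ω : ℝ) (w : C(I, ℝ)) (t : ℝ) : ℝ :=
  Real.cos (ω * t) * primitive (cosOn ω * w) t + Real.sin (ω * t) * primitive (sinOn ω * w) t

@[simp] lemma sineResponse_zero (ω : ℝ) (w : C(I, ℝ)) : sineResponse ω w 0 = 0 := by
  simp [sineResponse]

@[simp] lemma cosineResponse_zero (ω : ℝ) (w : C(I, ℝ)) : cosineResponse ω w 0 = 0 := by
  simp [cosineResponse]

lemma hasDerivAt_sin_mul (ω t : ℝ) :
    HasDerivAt (fun t => Real.sin (ω * t)) (Real.cos (ω * t) * ω) t := by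
  simpa using ((hasDerivAt_id t).const_mul ω).sin

lemma hasDerivAt_cos_mul (ω t : ℝ) :
    HasDerivAt (fun t => Real.cos (ω * t)) (-Real.sin (ω * t) * ω) t := by
  simpa using ((hasDerivAt_id t).const_mul ω).cos

lemma hasDerivAt_sineResponse {ω : ℝ} (hω : ω ≠ 0) (w : C(I, ℝ)) {t : ℝ} (ht : t ∈ I) :
    HasDerivAt (sineResponse ω w) (cosineResponse ω w t) t := by
  have h1 := (hasDerivAt_sin_mul ω t).mul (hasDerivAt_primitive (cosOn ω * w) ht)
  have h2 := (hasDerivAt_cos_mul ω t).mul (hasDerivAt_primitive (sinOn ω * w) ht)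
  refine ((h1.sub h2).const_mul ω⁻¹).congr_deriv ?_
  simp only [cosineResponse, ContinuousMap.mul_apply, sinOn_apply, cosOn_apply]
  field_simp
  ring

lemma hasDerivAt_cosineResponse (ω : ℝ) (w : C(I, ℝ)) {t : ℝ} (ht : t ∈ I) :
    HasDerivAt (cosineResponse ω w) (w ⟨t, ht⟩ - ω ^ 2 * sineResponse ω w t) t := by
  have h1 := (hasDerivAt_cos_mul ω t).mul (hasDerivAt_primitive (cosOn ω * w) ht)
  have h2 := (hasDerivAt_sin_mul ω t).mul (hasDerivAt_primitive (sinOn ω * w) ht)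
  refine (h1.add h2).congr_deriv ?_
  simp only [sineResponse, ContinuousMap.mul_apply, sinOn_apply, cosOn_apply]
  field_simp
  linear_combination (w ⟨t, ht⟩) * Real.sin_sq_add_cos_sq (ω * t)

/-- `HipHop.sineResponse ω` as a bounded operator on `C([0, 1])`. -/
def sineResponseCLM (ω : ℝ) : C(I, ℝ) →L[ℝ] C(I, ℝ) :=
  ω⁻¹ • (ContinuousLinearMap.mul ℝ C(I, ℝ) (sinOn ω) ∘L primitiveCLM ∘L
      ContinuousLinearMap.mul ℝ C(I, ℝ) (cosOn ω)
    - ContinuousLinearMap.mul ℝ C(I, ℝ) (cosOn ω) ∘L primitiveCLM ∘L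
      ContinuousLinearMap.mul ℝ C(I, ℝ) (sinOn ω))

@[simp] lemma sineResponseCLM_apply (ω : ℝ) (w : C(I, ℝ)) (s : I) :
    sineResponseCLM ω w s = sineResponse ω w s := rfl

/-- The final velocity `cosineResponse ω w 1` as a bounded functional of the forcing `w`. -/
def finalVelocity (ω : ℝ) : C(I, ℝ) →L[ℝ] ℝ :=
  ContinuousMap.evalCLM ℝ (1 : I) ∘L
    (ContinuousLinearMap.mul ℝ C(I, ℝ) (cosOn ω) ∘L primitiveCLM ∘L
      ContinuousLinearMap.mul ℝ C(I, ℝ) (cosOn ω)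
    + ContinuousLinearMap.mul ℝ C(I, ℝ) (sinOn ω) ∘L primitiveCLM ∘L
      ContinuousLinearMap.mul ℝ C(I, ℝ) (sinOn ω))

@[simp] lemma finalVelocity_apply (ω : ℝ) (w : C(I, ℝ)) :
    finalVelocity ω w = cosineResponse ω w 1 := rfl

lemma finalVelocity_one {ω : ℝ} (hω : ω ≠ 0) : finalVelocity ω 1 = Real.sin ω / ω := by
  have h1 : primitive (cosOn ω * 1) 1 = Real.sin ω / ω := by
    rw [primitive_eq_integral _ (k := fun τ => Real.cos (ω * τ)) (by simp),
      intervalIntegral.integral_comp_mul_left _ hω]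
    simp [div_eq_inv_mul]
  have h2 : primitive (sinOn ω * 1) 1 = (1 - Real.cos ω) / ω := by
    rw [primitive_eq_integral _ (k := fun τ => Real.sin (ω * τ)) (by simp),
      intervalIntegral.integral_comp_mul_left _ hω]
    simp [div_eq_inv_mul]
  rw [finalVelocity_apply, cosineResponse, h1, h2]
  simp only [mul_one]
  field_simp
  ring

/-- Resonant forcing: the response to `sin (π s)` does not vanish at the end of the interval. -/
lemma sineResponse_pi_sin : sineResponse Real.pi (sinOn Real.pi) 1 = 1 / (2 * Real.pi) := by
  have hπ := Real.pi_ne_zero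
  have h : primitive (sinOn Real.pi * sinOn Real.pi) 1 = 1 / 2 := by
    rw [primitive_eq_integral _ (k := fun τ => Real.sin (Real.pi * τ) ^ 2) (by simp [sq]),
      intervalIntegral.integral_comp_mul_left (fun x => Real.sin x ^ 2) hπ]
    simp [integral_sin_sq]
    field_simp
  rw [sineResponse, h]
  simp

end HipHop

/-! ### The boundary value problem as an implicit equation in a Banach space -/

namespace HipHop

open unitInterval Filter Topology

/-- Unknowns `(r, u, a, T)` of the boundary value problem in rescaled time `s = t / T ∈ [0, 1]`:
the radius `r`, the height `u` divided by the initial velocity `b`, the angular momentum `a` and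
the half period `T`. -/
abbrev Unknown : Type := C(I, ℝ) × C(I, ℝ) × ℝ × ℝ

/-- The bounded linear map taking `(b, (r, u, a, T))` to the curve `s ↦ (b, r s, u s, a, T)`. -/
def bundle : ℝ × Unknown →L[ℝ] C(I, ℝ × ℝ × ℝ × ℝ × ℝ) :=
  LinearMap.mkContinuous
    { toFun := fun z => ⟨fun s => (z.1, z.2.1 s, z.2.2.1 s, z.2.2.2.1, z.2.2.2.2), by fun_prop⟩
      map_add' := fun _ _ => rfl
      map_smul' := fun _ _ => rfl }
    1 (fun z => by
      rw [one_mul]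
      refine (ContinuousMap.norm_le _ (norm_nonneg _)).2 fun s => ?_
      have h1 := z.2.1.norm_coe_le_norm s
      have h2 := z.2.2.1.norm_coe_le_norm s
      simp only [Prod.norm_def, LinearMap.coe_mk, AddHom.coe_mk, ContinuousMap.coe_mk] at *
      gcongr)

@[simp] lemma bundle_apply (z : ℝ × Unknown) (s : I) :
    bundle z s = (z.1, z.2.1 s, z.2.2.1 s, z.2.2.2.1, z.2.2.2.2) := rfl

/-- The solution `s ↦ sin (π s) / π` of the linearized height equation in rescaled time. -/
def halfSine : C(I, ℝ) := Real.pi⁻¹ • sinOn Real.pi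

@[simp] lemma halfSine_apply (s : I) : halfSine s = Real.pi⁻¹ * Real.sin (Real.pi * s) := rfl

/-- The equations of the boundary value problem
`r'' + μ² (r - r₀) = φ₁`, `r 0 = r₀`, `r' 0 = r' 1 = 0` and
`u'' + π² u = φ₂`, `u 0 = u 1 = 0`, `u' 0 = T`, in integrated form. Here `φ₁` and `φ₂` are
evaluated along `s ↦ (b, r s, u s, a, T)`. -/
def bvpMap (φ₁ φ₂ : C(ℝ × ℝ × ℝ × ℝ × ℝ, ℝ)) (μ r₀ : ℝ) (z : ℝ × Unknown) : Unknown :=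
  (z.2.1 - ContinuousMap.const I r₀ - sineResponseCLM μ (φ₁.comp (bundle z)),
    z.2.2.1 - z.2.2.2.2 • halfSine - sineResponseCLM Real.pi (φ₂.comp (bundle z)),
    finalVelocity μ (φ₁.comp (bundle z)),
    z.2.2.1 1)

/-- The circular solution at `b = 0`, with the linearized height in the second component. -/
def circular (r₀ a₀ T₀ : ℝ) : Unknown := (ContinuousMap.const I r₀, T₀ • halfSine, a₀, T₀)

/-- Evaluation of the height at the end of the rescaled time interval. -/
def evalOne : C(I, ℝ) →L[ℝ] ℝ := ContinuousMap.evalCLM ℝ (1 : I)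

@[simp] lemma evalOne_apply (w : C(I, ℝ)) : evalOne w = w 1 := rfl

variable {φ₁ φ₂ : C(ℝ × ℝ × ℝ × ℝ × ℝ, ℝ)}

lemma contDiff_bvpMap (h₁ : ContDiff ℝ 1 φ₁) (h₂ : ContDiff ℝ 1 φ₂) (μ r₀ : ℝ) :
    ContDiff ℝ 1 (bvpMap φ₁ φ₂ μ r₀) := by
  have n₁ : ContDiff ℝ 1 fun z => φ₁.comp (bundle z) :=
    (ContinuousMap.contDiff_comp_left (X := I) φ₁ h₁).comp bundle.contDiff
  have n₂ : ContDiff ℝ 1 fun z => φ₂.comp (bundle z) :=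
    (ContinuousMap.contDiff_comp_left (X := I) φ₂ h₂).comp bundle.contDiff
  have e : ContDiff ℝ 1 fun z : ℝ × Unknown => evalOne z.2.2.1 := by fun_prop
  exact ((contDiff_snd.fst.sub contDiff_const).sub
      ((sineResponseCLM μ).contDiff.comp n₁)).prodMk
    (((contDiff_snd.snd.fst).sub (contDiff_snd.snd.snd.snd.smul contDiff_const)).sub
      ((sineResponseCLM Real.pi).contDiff.comp n₂) |>.prodMk
    (((finalVelocity μ).contDiff.comp n₁).prodMk e))

/-- The derivative of `bvpMap` in the unknowns at the circular solution, when `φ₁` depends to first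
order only on `a` and `φ₂` only on `r` and `T`. -/
lemma fderiv_bvpMap_apply (h₁ : ContDiff ℝ 1 φ₁) (h₂ : ContDiff ℝ 1 φ₂) {r₀ a₀ T₀ A B C : ℝ}
    (μ : ℝ)
    (d₁ : ∀ u x y p q, fderiv ℝ φ₁ (0, r₀, u, a₀, T₀) (0, x, y, p, q) = A * p)
    (d₂ : ∀ u x y p q, fderiv ℝ φ₂ (0, r₀, u, a₀, T₀) (0, x, y, p, q) = (B * x + C * q) * u)
    (x y : C(I, ℝ)) (p q : ℝ) :
    fderiv ℝ (bvpMap φ₁ φ₂ μ r₀) (0, circular r₀ a₀ T₀) (0, x, y, p, q) =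
      (x - (A * p) • sineResponseCLM μ 1,
        y - q • halfSine - T₀ • (B • sineResponseCLM Real.pi (x * halfSine)
          + (C * q) • sineResponseCLM Real.pi halfSine),
        (A * p) • finalVelocity μ 1, y 1) := by
  have n (φ : C(ℝ × ℝ × ℝ × ℝ × ℝ, ℝ)) (h : ContDiff ℝ 1 φ) :=
    (ContinuousMap.hasFDerivAt_comp_left (X := I) φ ⟨fderiv ℝ φ, h.continuous_fderiv one_ne_zero⟩
      (fun v => (h.differentiable one_ne_zero v).hasFDerivAt)
      (bundle (0, circular r₀ a₀ T₀))).comp (0, circular r₀ a₀ T₀) bundle.hasFDerivAt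
  have hz := hasFDerivAt_snd (𝕜 := ℝ) (p := ((0 : ℝ), circular r₀ a₀ T₀))
  have hr := hz.fst
  have hu := hz.snd.fst
  have hT := hz.snd.snd.snd
  have key := ((hr.sub_const (ContinuousMap.const I r₀)).sub
      ((sineResponseCLM μ).hasFDerivAt.comp _ (n φ₁ h₁))).prodMk
    (((hu.sub (hT.smul_const halfSine)).sub
      ((sineResponseCLM Real.pi).hasFDerivAt.comp _ (n φ₂ h₂))).prodMk
    (((finalVelocity μ).hasFDerivAt.comp _ (n φ₁ h₁)).prodMk
      (evalOne.hasFDerivAt.comp _ hu)))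
  have e₁ : ContinuousMap.pointwiseApply ((⟨fderiv ℝ φ₁, h₁.continuous_fderiv one_ne_zero⟩ :
      C(ℝ × ℝ × ℝ × ℝ × ℝ, _)).comp (bundle (0, circular r₀ a₀ T₀))) (bundle (0, x, y, p, q))
      = (A * p) • (1 : C(I, ℝ)) := by
    ext s
    simp [circular, d₁]
  have e₂ : ContinuousMap.pointwiseApply ((⟨fderiv ℝ φ₂, h₂.continuous_fderiv one_ne_zero⟩ :
      C(ℝ × ℝ × ℝ × ℝ × ℝ, _)).comp (bundle (0, circular r₀ a₀ T₀))) (bundle (0, x, y, p, q))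
      = T₀ • (B • (x * halfSine) + (C * q) • halfSine) := by
    ext s
    simp [circular, d₂]
    ring
  have : fderiv ℝ (bvpMap φ₁ φ₂ μ r₀) (0, circular r₀ a₀ T₀) = _ := key.fderiv
  rw [this]
  simp only [ContinuousLinearMap.prod_apply, ContinuousLinearMap.comp_apply,
    sub_apply, e₁, e₂]
  simp

lemma isInvertible_fderiv_bvpMap (h₁ : ContDiff ℝ 1 φ₁) (h₂ : ContDiff ℝ 1 φ₂)
    {r₀ a₀ T₀ A B C μ : ℝ}
    (d₁ : ∀ u x y p q, fderiv ℝ φ₁ (0, r₀, u, a₀, T₀) (0, x, y, p, q) = A * p)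
    (d₂ : ∀ u x y p q, fderiv ℝ φ₂ (0, r₀, u, a₀, T₀) (0, x, y, p, q) = (B * x + C * q) * u)
    (hT₀ : T₀ ≠ 0) (hA : A ≠ 0) (hC : C ≠ 0) (hμ : μ ≠ 0) (hsin : Real.sin μ ≠ 0) :
    (fderiv ℝ (bvpMap φ₁ φ₂ μ r₀) (0, circular r₀ a₀ T₀) ∘L .inr ℝ ℝ Unknown).IsInvertible := by
  have hπ := Real.pi_ne_zero
  have hD (x y : C(I, ℝ)) (p q : ℝ) :
      (fderiv ℝ (bvpMap φ₁ φ₂ μ r₀) (0, circular r₀ a₀ T₀) ∘L .inr ℝ ℝ Unknown) (x, y, p, q) = _ :=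
    fderiv_bvpMap_apply h₁ h₂ μ d₁ d₂ x y p q
  set D := fderiv ℝ (bvpMap φ₁ φ₂ μ r₀) (0, circular r₀ a₀ T₀) ∘L .inr ℝ ℝ Unknown
  have c₁ : finalVelocity μ 1 ≠ 0 := by rw [finalVelocity_one hμ]; positivity
  have c₂ : sineResponseCLM Real.pi halfSine 1 = 1 / (2 * Real.pi ^ 2) := by
    rw [halfSine, map_smul, ContinuousMap.smul_apply, sineResponseCLM_apply]
    have := sineResponse_pi_sin
    simp only [Set.Icc.coe_one, smul_eq_mul, this]
    field_simp
  have c₃ : halfSine 1 = 0 := by simp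
  have hinj : Function.Injective D := by
    rw [injective_iff_map_eq_zero]
    rintro ⟨x, y, p, q⟩ h
    rw [hD] at h
    simp only [Prod.mk_eq_zero] at h
    obtain ⟨hx, hy, hp, hy1⟩ := h
    have hp0 : p = 0 := by simpa [hA, c₁, -finalVelocity_apply] using hp
    have hx0 : x = 0 := by simpa [hp0] using hx
    have hq0 : q = 0 := by
      have := congrArg (fun w : C(I, ℝ) => w 1) hy
      simpa only [hx0, zero_mul, map_zero, smul_zero, zero_add, ContinuousMap.sub_apply,
        ContinuousMap.smul_apply, c₂, c₃, hy1, sub_zero, zero_sub, smul_eq_mul, mul_zero,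
        ContinuousMap.zero_apply, neg_eq_zero, mul_eq_zero, hT₀, hC, false_or,
        (by positivity : (1 : ℝ) / (2 * Real.pi ^ 2) ≠ 0), or_false] using this
    have hy0 : y = 0 := by simpa [hx0, hq0] using hy
    simp [hx0, hy0, hp0, hq0]
  have hsurj : Function.Surjective D := by
    rintro ⟨z₁, z₂, z₃, z₄⟩
    -- The third equation fixes `p`, then the first fixes `x`, and `q` is chosen so that the height
    -- given by the second equation has the prescribed value at `1`.
    set p := z₃ / (A * finalVelocity μ 1) with hp
    set x := z₁ + (A * p) • sineResponseCLM μ 1 with hx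
    set ℓ := sineResponseCLM Real.pi (x * halfSine) 1 with hℓ
    set q := (z₄ - z₂ 1 - T₀ * B * ℓ) * (2 * Real.pi ^ 2) / (T₀ * C) with hq
    refine ⟨(x, z₂ + q • halfSine + T₀ • (B • sineResponseCLM Real.pi (x * halfSine)
          + (C * q) • sineResponseCLM Real.pi halfSine), p, q), ?_⟩
    rw [hD]
    refine Prod.ext ?_ (Prod.ext ?_ (Prod.ext ?_ ?_))
    · simp [hx]
    · dsimp only
      abel
    · simp only [hp, smul_eq_mul]
      field_simp
    · simp only [ContinuousMap.add_apply, ContinuousMap.smul_apply, c₂, c₃, ← hℓ, smul_eq_mul,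
        mul_zero, add_zero]
      rw [hq]
      field_simp
      ring
  exact ⟨ContinuousLinearEquiv.ofBijective D (LinearMap.ker_eq_bot.2 hinj)
    (LinearMap.range_eq_top.2 hsurj), rfl⟩

/-- The circular solution continues to a `C¹` family of solutions of the boundary value problem. -/
lemma exists_contDiffAt_bvpMap_eq_zero (h₁ : ContDiff ℝ 1 φ₁) (h₂ : ContDiff ℝ 1 φ₂)
    {r₀ a₀ T₀ A B C μ : ℝ}
    (v₁ : ∀ u, φ₁ (0, r₀, u, a₀, T₀) = 0) (v₂ : ∀ u, φ₂ (0, r₀, u, a₀, T₀) = 0)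
    (d₁ : ∀ u x y p q, fderiv ℝ φ₁ (0, r₀, u, a₀, T₀) (0, x, y, p, q) = A * p)
    (d₂ : ∀ u x y p q, fderiv ℝ φ₂ (0, r₀, u, a₀, T₀) (0, x, y, p, q) = (B * x + C * q) * u)
    (hT₀ : T₀ ≠ 0) (hA : A ≠ 0) (hC : C ≠ 0) (hμ : μ ≠ 0) (hsin : Real.sin μ ≠ 0) :
    ∃ ψ : ℝ → Unknown, ContDiffAt ℝ 1 ψ 0 ∧ ψ 0 = circular r₀ a₀ T₀ ∧
      ∀ᶠ b in 𝓝 0, bvpMap φ₁ φ₂ μ r₀ (b, ψ b) = 0 := by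
  have cd : ContDiffAt ℝ 1 (bvpMap φ₁ φ₂ μ r₀) (0, circular r₀ a₀ T₀) :=
    (contDiff_bvpMap h₁ h₂ μ r₀).contDiffAt
  have inv := isInvertible_fderiv_bvpMap h₁ h₂ d₁ d₂ hT₀ hA hC hμ hsin
  refine ⟨cd.implicitFunction one_ne_zero inv, cd.contDiffAt_implicitFunction one_ne_zero inv,
    cd.implicitFunction_apply_self one_ne_zero inv, ?_⟩
  have base : bvpMap φ₁ φ₂ μ r₀ (0, circular r₀ a₀ T₀) = 0 := by
    have e₁ : φ₁.comp (bundle (0, circular r₀ a₀ T₀)) = 0 := by ext s; simp [circular, v₁]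
    have e₂ : φ₂.comp (bundle (0, circular r₀ a₀ T₀)) = 0 := by ext s; simp [circular, v₂]
    simp only [bvpMap, e₁, e₂, map_zero, sub_zero]
    simp [circular]
  have := cd.eventually_apply_implicitFunction one_ne_zero inv
  rwa [base] at this

end HipHop

/-! ### Solutions of the boundary value problem in physical time -/

namespace HipHop

open unitInterval Filter Topology

/-- `(r, d)`, with velocities `(r', d')`, solves `r'' = P (a, r, d)`, `d'' = d * H (r, d)` on the
time interval `[0, T]`, starting from `r = r₀`, `r' = 0`, `d = 0`, `d' = b` and ending with
`r' = 0`, `d = 0`. The derivatives are two-sided also at the ends of the interval. -/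
structure IsArc (P : ℝ × ℝ × ℝ → ℝ) (H : ℝ × ℝ → ℝ) (r₀ a b T : ℝ) (r r' d d' : ℝ → ℝ) :
    Prop where
  hasDerivAt_r : ∀ t ∈ Set.Icc 0 T, HasDerivAt r (r' t) t
  hasDerivAt_r' : ∀ t ∈ Set.Icc 0 T, HasDerivAt r' (P (a, r t, d t)) t
  hasDerivAt_d : ∀ t ∈ Set.Icc 0 T, HasDerivAt d (d' t) t
  hasDerivAt_d' : ∀ t ∈ Set.Icc 0 T, HasDerivAt d' (d t * H (r t, d t)) t
  r_zero : r 0 = r₀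
  r'_zero : r' 0 = 0
  d_zero : d 0 = 0
  d'_zero : d' 0 = b
  r'_end : r' T = 0
  d_end : d T = 0

section

variable {P : ℝ × ℝ × ℝ → ℝ} {H : ℝ × ℝ → ℝ}

/-- The forcing of the oscillator `r'' + μ² (r - r₀) = radialForcing` in rescaled time. -/
def radialForcing (P : ℝ × ℝ × ℝ → ℝ) (hP : Continuous P) (μ r₀ : ℝ) :
    C(ℝ × ℝ × ℝ × ℝ × ℝ, ℝ) :=
  ⟨fun v => v.2.2.2.2 ^ 2 * P (v.2.2.2.1, v.2.1, v.1 * v.2.2.1) + μ ^ 2 * (v.2.1 - r₀),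
    by fun_prop⟩

/-- The forcing of the oscillator `u'' + π² u = heightForcing` in rescaled time. -/
def heightForcing (H : ℝ × ℝ → ℝ) (hH : Continuous H) : C(ℝ × ℝ × ℝ × ℝ × ℝ, ℝ) :=
  ⟨fun v => v.2.2.2.2 ^ 2 * (v.2.2.1 * H (v.2.1, v.1 * v.2.2.1)) + Real.pi ^ 2 * v.2.2.1,
    by fun_prop⟩

lemma contDiff_radialForcing (hP : ContDiff ℝ 1 P) (μ r₀ : ℝ) :
    ContDiff ℝ 1 (radialForcing P hP.continuous μ r₀) := by
  change ContDiff ℝ 1 fun v : ℝ × ℝ × ℝ × ℝ × ℝ =>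
    v.2.2.2.2 ^ 2 * P (v.2.2.2.1, v.2.1, v.1 * v.2.2.1) + μ ^ 2 * (v.2.1 - r₀)
  fun_prop

lemma contDiff_heightForcing (hH : ContDiff ℝ 1 H) :
    ContDiff ℝ 1 (heightForcing H hH.continuous) := by
  change ContDiff ℝ 1 fun v : ℝ × ℝ × ℝ × ℝ × ℝ =>
    v.2.2.2.2 ^ 2 * (v.2.2.1 * H (v.2.1, v.1 * v.2.2.1)) + Real.pi ^ 2 * v.2.2.1
  fun_prop

lemma hasDerivAt_line_of_differentiableAt {V : Type*} [NormedAddCommGroup V] [NormedSpace ℝ V]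
    {φ : V → ℝ} {v : V} (hφ : DifferentiableAt ℝ φ v) (w : V) :
    HasDerivAt (fun t : ℝ => φ (v + t • w)) (fderiv ℝ φ v w) 0 := by
  have hl : HasDerivAt (fun t : ℝ => v + t • w) w 0 := by
    simpa using ((hasDerivAt_id (0 : ℝ)).smul_const w).const_add v
  have hφ' : HasFDerivAt φ (fderiv ℝ φ v) (v + (0 : ℝ) • w) := by
    simpa using hφ.hasFDerivAt
  exact hφ'.comp_hasDerivAt (0 : ℝ) hl

/-- Directional derivatives can be computed along affine lines, where only one-variable calculus is
needed. -/
lemma fderiv_apply_eq_of_hasDerivAt_line {V : Type*} [NormedAddCommGroup V] [NormedSpace ℝ V]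
    {φ : V → ℝ} {v w : V} {c : ℝ} (hφ : DifferentiableAt ℝ φ v)
    (h : HasDerivAt (fun t : ℝ => φ (v + t • w)) c 0) : fderiv ℝ φ v w = c :=
  (hasDerivAt_line_of_differentiableAt hφ w).unique h

lemma hasDerivAt_affine (c q : ℝ) : HasDerivAt (fun t : ℝ => c + t * q) q 0 := by
  simpa using ((hasDerivAt_id (0 : ℝ)).mul_const q).const_add c

lemma fderiv_radialForcing (hP : ContDiff ℝ 1 P) {r₀ a₀ T₀ κ ν : ℝ} (hP₀ : P (a₀, r₀, 0) = 0)
    (dP : ∀ p x, fderiv ℝ P (a₀, r₀, 0) (p, x, 0) = κ * p - ν ^ 2 * x) (u x y p q : ℝ) :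
    fderiv ℝ (radialForcing P hP.continuous (T₀ * ν) r₀) (0, r₀, u, a₀, T₀) (0, x, y, p, q)
      = T₀ ^ 2 * κ * p := by
  refine fderiv_apply_eq_of_hasDerivAt_line
    ((contDiff_radialForcing hP _ _).differentiable one_ne_zero _) ?_
  have h1 := hasDerivAt_line_of_differentiableAt
    (hP.differentiable one_ne_zero (a₀, r₀, 0)) (p, x, 0)
  rw [dP] at h1
  have h2 := ((hasDerivAt_affine T₀ q).pow 2).mul h1
  have h3 := ((hasDerivAt_affine r₀ x).sub_const r₀).const_mul ((T₀ * ν) ^ 2)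
  refine ((h2.add h3).congr_deriv ?_).congr_of_eventuallyEq (Eventually.of_forall fun t => ?_)
  · simp [hP₀]
    ring
  · simp [radialForcing]

lemma fderiv_heightForcing (hH : ContDiff ℝ 1 H) {r₀ a₀ T₀ ω : ℝ} (hH₀ : H (r₀, 0) = -ω ^ 2)
    (hT₀ : T₀ * ω = Real.pi) (u x y p q : ℝ) :
    fderiv ℝ (heightForcing H hH.continuous) (0, r₀, u, a₀, T₀) (0, x, y, p, q)
      = (T₀ ^ 2 * fderiv ℝ H (r₀, 0) (1, 0) * x + (-2 * T₀ * ω ^ 2) * q) * u := by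
  refine fderiv_apply_eq_of_hasDerivAt_line
    ((contDiff_heightForcing hH).differentiable one_ne_zero _) ?_
  have h1 := hasDerivAt_line_of_differentiableAt
    (hH.differentiable one_ne_zero (r₀, 0)) (x, 0)
  have h2 := ((hasDerivAt_affine T₀ q).pow 2).mul ((hasDerivAt_affine u y).mul h1)
  have h3 := (hasDerivAt_affine u y).const_mul (Real.pi ^ 2)
  have hx : fderiv ℝ H (r₀, 0) (x, 0) = x * fderiv ℝ H (r₀, 0) (1, 0) := by
    rw [← smul_eq_mul, ← map_smul]
    simp
  refine ((h2.add h3).congr_deriv ?_).congr_of_eventuallyEq (Eventually.of_forall fun t => ?_)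
  · simp [hH₀, hx, ← hT₀]
    ring
  · simp [heightForcing]

/-- A zero of `bvpMap` is a solution of the boundary value problem. -/
lemma exists_isArc_of_bvpMap_eq_zero (hP : Continuous P) (hH : Continuous H) {r₀ μ b : ℝ}
    (hμ : μ ≠ 0) {z : Unknown} (hT : 0 < z.2.2.2)
    (h : bvpMap (radialForcing P hP μ r₀) (heightForcing H hH) μ r₀ (b, z) = 0) :
    ∃ r r' d d' : ℝ → ℝ, IsArc P H r₀ z.2.2.1 b z.2.2.2 r r' d d' ∧
      ∀ t ∈ Set.Icc 0 z.2.2.2, |r t - r₀| ≤ ‖z.1 - ContinuousMap.const I r₀‖ := by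
  obtain ⟨x, u, a, T⟩ := z
  have hπ := Real.pi_ne_zero
  dsimp only at hT ⊢
  have hT' := hT.ne'
  set w₁ := (radialForcing P hP μ r₀).comp (bundle (b, x, u, a, T)) with hw₁
  set w₂ := (heightForcing H hH).comp (bundle (b, x, u, a, T)) with hw₂
  simp only [bvpMap, ← hw₁, ← hw₂, Prod.mk_eq_zero, finalVelocity_apply] at h
  obtain ⟨hx, hu, hr1, hu1⟩ := h
  have hx' (s : ℝ) (hs : s ∈ I) : x ⟨s, hs⟩ = r₀ + sineResponse μ w₁ s := by
    have := congrArg (fun w : C(I, ℝ) => w ⟨s, hs⟩) hx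
    simp at this
    linarith
  have hu' (s : ℝ) (hs : s ∈ I) :
      u ⟨s, hs⟩ = T * (Real.pi⁻¹ * Real.sin (Real.pi * s)) + sineResponse Real.pi w₂ s := by
    have := congrArg (fun w : C(I, ℝ) => w ⟨s, hs⟩) hu
    simp at this
    linarith
  have mem (t : ℝ) (ht : t ∈ Set.Icc 0 T) : T⁻¹ * t ∈ I := by
    rw [← div_eq_inv_mul]
    exact ⟨div_nonneg ht.1 hT.le, div_le_one_of_le₀ ht.2 hT.le⟩
  have scale (t : ℝ) : HasDerivAt (fun t => T⁻¹ * t) T⁻¹ t := by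
    simpa using (hasDerivAt_id t).const_mul T⁻¹
  set R : ℝ → ℝ := fun s => r₀ + sineResponse μ w₁ s with hR
  set U : ℝ → ℝ := fun s => T * (Real.pi⁻¹ * Real.sin (Real.pi * s)) + sineResponse Real.pi w₂ s
    with hU
  have dR (s : ℝ) (hs : s ∈ I) : HasDerivAt R (cosineResponse μ w₁ s) s :=
    (hasDerivAt_sineResponse hμ w₁ hs).const_add r₀
  have dR' (s : ℝ) (hs : s ∈ I) :
      HasDerivAt (cosineResponse μ w₁) (T ^ 2 * P (a, R s, b * U s)) s := by
    refine (hasDerivAt_cosineResponse μ w₁ hs).congr_deriv ?_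
    simp only [hw₁, radialForcing, ContinuousMap.comp_apply, ContinuousMap.coe_mk, bundle_apply,
      hx' s hs, hu' s hs, hR, hU]
    ring
  have dU (s : ℝ) (hs : s ∈ I) :
      HasDerivAt U (T * Real.cos (Real.pi * s) + cosineResponse Real.pi w₂ s) s := by
    refine ((((hasDerivAt_sin_mul Real.pi s).const_mul Real.pi⁻¹).const_mul T).add
      (hasDerivAt_sineResponse hπ w₂ hs)).congr_deriv ?_
    field_simp
  have dU' (s : ℝ) (hs : s ∈ I) :
      HasDerivAt (fun s => T * Real.cos (Real.pi * s) + cosineResponse Real.pi w₂ s)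
        (T ^ 2 * (U s * H (R s, b * U s))) s := by
    refine (((hasDerivAt_cos_mul Real.pi s).const_mul T).add
      (hasDerivAt_cosineResponse Real.pi w₂ hs)).congr_deriv ?_
    simp only [hw₂, heightForcing, ContinuousMap.comp_apply, ContinuousMap.coe_mk, bundle_apply,
      hx' s hs, hu' s hs, hR, hU]
    field_simp
    ring
  have one : T⁻¹ * T = 1 := inv_mul_cancel₀ hT'
  refine ⟨fun t => R (T⁻¹ * t), fun t => T⁻¹ * cosineResponse μ w₁ (T⁻¹ * t),
    fun t => b * U (T⁻¹ * t),
    fun t => b * (T⁻¹ * (T * Real.cos (Real.pi * (T⁻¹ * t))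
      + cosineResponse Real.pi w₂ (T⁻¹ * t))), ⟨?_, ?_, ?_, ?_, ?_, ?_, ?_, ?_, ?_, ?_⟩, ?_⟩
  · intro t ht
    exact ((dR _ (mem t ht)).comp t (scale t)).congr_deriv (mul_comm _ _)
  · intro t ht
    refine (((dR' _ (mem t ht)).comp t (scale t)).const_mul T⁻¹).congr_deriv ?_
    field_simp
  · intro t ht
    refine (((dU _ (mem t ht)).comp t (scale t)).const_mul b).congr_deriv ?_
    ring
  · intro t ht
    refine ((((dU' _ (mem t ht)).comp t (scale t)).const_mul T⁻¹).const_mul b).congr_deriv ?_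
    field_simp
  · simp [hR]
  · simp
  · simp [hU]
  · simp [hT']
  · simp only [one, hr1, mul_zero]
  · have h1 : U 1 = 0 := by
      rw [← hu1, show (1 : I) = ⟨1, unitInterval.one_mem⟩ from rfl, hu' 1 unitInterval.one_mem]
    simp only [one, h1, mul_zero]
  · intro t ht
    have := (x - ContinuousMap.const I r₀).norm_coe_le_norm ⟨_, mem t ht⟩
    rwa [ContinuousMap.sub_apply, hx' _ (mem t ht)] at this

/-- **Bifurcation from a circular solution.** If the linearization at the circular solution is
`x'' = -ν² x + κ δa`, `y'' = -ω² y` and `sin (ν π / ω) ≠ 0`, the solution which moves vertically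
with velocity `b` at time `0` reaches `r' = 0`, `d = 0` again at a time near `π / ω`, for a suitable
value of `a`, and both depend on `b` in a `C¹` way. -/
theorem exists_isArc_family (hP : ContDiff ℝ 1 P) (hH : ContDiff ℝ 1 H) {r₀ a₀ κ ν ω ε : ℝ}
    (hP₀ : P (a₀, r₀, 0) = 0)
    (dP : ∀ p x, fderiv ℝ P (a₀, r₀, 0) (p, x, 0) = κ * p - ν ^ 2 * x)
    (hH₀ : H (r₀, 0) = -ω ^ 2) (hκ : κ ≠ 0) (hν : ν ≠ 0) (hω : 0 < ω)
    (hsin : Real.sin (Real.pi / ω * ν) ≠ 0) (hε : 0 < ε) :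
    ∃ (δ : ℝ) (T a : ℝ → ℝ), 0 < δ ∧ ContDiffOn ℝ 1 T (Set.Ioo (-δ) δ) ∧
      ContDiffOn ℝ 1 a (Set.Ioo (-δ) δ) ∧ T 0 = Real.pi / ω ∧ a 0 = a₀ ∧
      ∀ b ∈ Set.Ioo (-δ) δ, 0 < T b ∧ ∃ r r' d d' : ℝ → ℝ,
        IsArc P H r₀ (a b) b (T b) r r' d d' ∧ ∀ t ∈ Set.Icc 0 (T b), |r t - r₀| < ε := by
  have hπ := Real.pi_pos
  have hT₀ : 0 < Real.pi / ω := by positivity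
  have hT₀ω : Real.pi / ω * ω = Real.pi := by field_simp
  obtain ⟨ψ, hψ, hψ0, hev⟩ := exists_contDiffAt_bvpMap_eq_zero
    (contDiff_radialForcing hP (Real.pi / ω * ν) r₀) (contDiff_heightForcing hH)
    (r₀ := r₀) (a₀ := a₀) (T₀ := Real.pi / ω) (μ := Real.pi / ω * ν)
    (fun u => by simp [radialForcing, hP₀])
    (fun u => by simp [heightForcing, hH₀]; field_simp; ring)
    (fderiv_radialForcing hP hP₀ dP) (fderiv_heightForcing hH hH₀ hT₀ω) hT₀.ne'
    (by positivity) (by simp [hT₀.ne', hω.ne']) (by positivity) hsin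
  have hc : ContinuousAt ψ 0 := hψ.continuousAt
  have hTpos : ∀ᶠ b in 𝓝 0, 0 < (ψ b).2.2.2 :=
    (hc.snd.snd.snd).eventually (lt_mem_nhds (by simpa [hψ0, circular] using hT₀))
  have hclose : ∀ᶠ b in 𝓝 0, ‖(ψ b).1 - ContinuousMap.const I r₀‖ < ε := by
    have : ContinuousAt (fun b => ‖(ψ b).1 - ContinuousMap.const I r₀‖) 0 :=
      (hc.fst.sub continuousAt_const).norm
    exact this.eventually (gt_mem_nhds (by simpa [hψ0, circular] using hε))
  have hdiff : ∀ᶠ b in 𝓝 0, ContDiffAt ℝ 1 ψ b := hψ.eventually (by simp)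
  obtain ⟨δ, hδ, hball⟩ :=
    Metric.eventually_nhds_iff_ball.1 (((hev.and hTpos).and hclose).and hdiff)
  rw [Real.ball_eq_Ioo, zero_sub, zero_add] at hball
  refine ⟨δ, fun b => (ψ b).2.2.2, fun b => (ψ b).2.2.1, hδ,
    fun b hb => ((hball b hb).2.snd.snd.snd).contDiffWithinAt,
    fun b hb => ((hball b hb).2.snd.snd.fst).contDiffWithinAt, by simp [hψ0, circular],
    by simp [hψ0, circular], fun b hb => ?_⟩
  obtain ⟨⟨⟨h1, h2⟩, h3⟩, -⟩ := hball b hb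
  obtain ⟨r, r', d, d', harc, hr⟩ :=
    exists_isArc_of_bvpMap_eq_zero hP.continuous hH.continuous (by positivity) h2 h1
  exact ⟨h2, r, r', d, d', harc, fun t ht => (hr t ht).trans_lt h3⟩

end

end HipHop

/-! ### Periodic extension by reflections -/

namespace HipHop

open Filter Topology

/-- The copy of `p` on the interval `[n T, (n + 1) T]`: a translate for even `n`, and `σ` times a
reflected translate for odd `n`. -/
def reflectPiece (σ T : ℝ) (p : ℝ → ℝ) (n : ℤ) (t : ℝ) : ℝ :=
  if Even n then p (t - n * T) else σ * p ((n + 1) * T - t)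

/-- The extension of `p` from `[0, T]` to `ℝ` by successive reflections at the multiples of `T`;
for `σ = 1` it is even and for `σ = -1` odd about each of them. -/
def reflectExtend (σ T : ℝ) (p : ℝ → ℝ) (t : ℝ) : ℝ := reflectPiece σ T p ⌊t / T⌋ t

variable {σ T : ℝ} {p q : ℝ → ℝ}

lemma reflectExtend_periodic (hT : 0 < T) : Function.Periodic (reflectExtend σ T p) (2 * T) := by
  intro t
  have h : ⌊(t + 2 * T) / T⌋ = ⌊t / T⌋ + 2 := by
    rw [add_div, mul_div_cancel_right₀ _ hT.ne']
    exact_mod_cast Int.floor_add_ofNat (t / T) 2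
  have he : Even (⌊t / T⌋ + 2) ↔ Even ⌊t / T⌋ := by simp
  simp only [reflectExtend, reflectPiece, h, he]
  push_cast
  ring_nf

/-- At the common end of two intervals either piece may be used. -/
lemma reflectExtend_eq (hT : 0 < T) (h0 : σ * p 0 = p 0) (h1 : σ * p T = p T) {n : ℤ} {t : ℝ}
    (ht : t ∈ Set.Icc (n * T) ((n + 1) * T)) : reflectExtend σ T p t = reflectPiece σ T p n t := by
  rcases ht.2.lt_or_eq with h | rfl
  · have : ⌊t / T⌋ = n := by
      rw [Int.floor_eq_iff, le_div_iff₀ hT, div_lt_iff₀ hT]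
      exact ⟨ht.1, h⟩
    rw [reflectExtend, this]
  · have : ⌊((n : ℝ) + 1) * T / T⌋ = n + 1 := by
      rw [mul_div_cancel_right₀ _ hT.ne']
      exact_mod_cast Int.floor_intCast (n + 1)
    rw [reflectExtend, this, reflectPiece, reflectPiece]
    by_cases hn : Even n
    · simp [hn, add_mul, h1]
    · simp [hn, h0]

lemma reflectExtend_of_mem (hT : 0 < T) (h0 : σ * p 0 = p 0) (h1 : σ * p T = p T) {t : ℝ}
    (ht : t ∈ Set.Icc 0 T) : reflectExtend σ T p t = p t := by
  rw [reflectExtend_eq hT h0 h1 (n := 0) (by simpa using ht)]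
  simp [reflectPiece]

/-- Every value of the extension is a value on `[0, T]` up to the sign `σ`; the sign and the
point may be chosen for several functions at once. -/
lemma exists_reflectExtend_eq (hT : 0 < T) (t : ℝ) : ∃ s ∈ Set.Icc 0 T,
    (∀ σ p, reflectExtend σ T p t = p s) ∨ (∀ σ p, reflectExtend σ T p t = σ * p s) := by
  have h1 : ⌊t / T⌋ * T ≤ t := (le_div_iff₀ hT).1 (Int.floor_le _)
  have h2 : t < (⌊t / T⌋ + 1) * T := (div_lt_iff₀ hT).1 (Int.lt_floor_add_one _)
  by_cases hn : Even ⌊t / T⌋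
  · exact ⟨t - ⌊t / T⌋ * T, ⟨by linarith, by linarith⟩,
      .inl fun σ p => by simp [reflectExtend, reflectPiece, hn]⟩
  · exact ⟨(⌊t / T⌋ + 1) * T - t, ⟨by linarith, by linarith⟩,
      .inr fun σ p => by simp [reflectExtend, reflectPiece, hn]⟩

lemma hasDerivAt_reflectPiece (hpq : ∀ t ∈ Set.Icc 0 T, HasDerivAt p (q t) t) {n : ℤ} {t : ℝ}
    (ht : t ∈ Set.Icc (n * T) ((n + 1) * T)) :
    HasDerivAt (reflectPiece σ T p n) (reflectPiece (-σ) T q n t) t := by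
  obtain ⟨h1, h2⟩ := ht
  by_cases hn : Even n
  · have e : reflectPiece σ T p n = fun t => p (t - n * T) := by
      funext t
      simp [reflectPiece, hn]
    rw [e, reflectPiece, if_pos hn]
    exact (hpq (t - n * T) ⟨by linarith, by linarith⟩).comp_sub_const t _
  · have e : reflectPiece σ T p n = fun t => σ * p ((n + 1) * T - t) := by
      funext t
      simp [reflectPiece, hn]
    rw [e, reflectPiece, if_neg hn]
    refine (((hpq ((n + 1) * T - t) ⟨by linarith, by linarith⟩).comp_const_sub _ t).const_mul
      σ).congr_deriv (by ring)

/-- The extension of `p` with sign `σ` has the extension of its derivative with sign `-σ` as its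
derivative, also at the multiples of `T`, if `p` and its derivative have the required symmetry at
both ends of `[0, T]`. -/
lemma hasDerivAt_reflectExtend (hT : 0 < T) (hpq : ∀ t ∈ Set.Icc 0 T, HasDerivAt p (q t) t)
    (hp0 : σ * p 0 = p 0) (hp1 : σ * p T = p T) (hq0 : -σ * q 0 = q 0) (hq1 : -σ * q T = q T)
    (t : ℝ) : HasDerivAt (reflectExtend σ T p) (reflectExtend (-σ) T q t) t := by
  have key (n : ℤ) (ht : t ∈ Set.Icc (n * T) ((n + 1) * T)) :
      HasDerivWithinAt (reflectExtend σ T p) (reflectExtend (-σ) T q t)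
        (Set.Icc (n * T) ((n + 1) * T)) t := by
    rw [reflectExtend_eq hT hq0 hq1 ht]
    exact (hasDerivAt_reflectPiece hpq ht).hasDerivWithinAt.congr
      (fun s hs => reflectExtend_eq hT hp0 hp1 hs) (reflectExtend_eq hT hp0 hp1 ht)
  have hr : HasDerivWithinAt (reflectExtend σ T p) (reflectExtend (-σ) T q t) (Set.Ici t) t := by
    have h1 : ⌊t / T⌋ * T ≤ t := (le_div_iff₀ hT).1 (Int.floor_le _)
    have h2 : t < (⌊t / T⌋ + 1) * T := (div_lt_iff₀ hT).1 (Int.lt_floor_add_one _)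
    exact (key _ ⟨h1, h2.le⟩).mono_of_mem_nhdsWithin
      (mem_of_superset (Icc_mem_nhdsGE h2) (Set.Icc_subset_Icc_left h1))
  have hl : HasDerivWithinAt (reflectExtend σ T p) (reflectExtend (-σ) T q t) (Set.Iic t) t := by
    have h1 : ((⌈t / T⌉ - 1 : ℤ) : ℝ) * T < t := by
      rw [← lt_div_iff₀ hT]
      push_cast
      linarith [Int.ceil_lt_add_one (t / T)]
    have h2 : t ≤ ((⌈t / T⌉ - 1 : ℤ) + 1 : ℝ) * T := by
      rw [← div_le_iff₀ hT]
      push_cast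
      linarith [Int.le_ceil (t / T)]
    exact (key _ ⟨h1.le, h2⟩).mono_of_mem_nhdsWithin
      (mem_of_superset (Icc_mem_nhdsLE h1) (Set.Icc_subset_Icc_right h2))
  rw [← hasDerivWithinAt_univ, ← Set.Iic_union_Ici (a := t)]
  exact hl.union hr

end HipHop

/-! ### The force functions of the antiprism problem -/

namespace HipHop

open Filter Topology

variable {N : ℕ}

lemma sin_pos_of_mem_Icc {k : ℕ} (hk : k ∈ Finset.Icc 1 (2 * N - 1)) :
    0 < Real.sin (k * Real.pi / (2 * N)) := by
  rw [Finset.mem_Icc] at hk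
  have hN : 0 < N := by omega
  have h1 : (0 : ℝ) < k := by exact_mod_cast hk.1
  have h2 : (k : ℝ) < 2 * N := by exact_mod_cast (by omega : k < 2 * N)
  have hN' : (0 : ℝ) < N := by exact_mod_cast hN
  apply Real.sin_pos_of_pos_of_lt_pi
  · positivity
  · rw [div_lt_iff₀ (by positivity), mul_comm]
    gcongr

lemma separation_pos {k : ℕ} (hk : k ∈ Finset.Icc 1 (2 * N - 1)) {r : ℝ} (hr : 0 < r) (d : ℝ) :
    0 < 4 * r ^ 2 * Real.sin (k * Real.pi / (2 * N)) ^ 2 + ((-1) ^ k - 1) ^ 2 * d ^ 2 := by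
  have := sin_pos_of_mem_Icc hk
  positivity

lemma rpow_three_halves {r s : ℝ} (hr : 0 < r) (hs : 0 < s) (c : ℝ) :
    (4 * r ^ 2 * s ^ 2 + c * 0 ^ 2) ^ (3 / 2 : ℝ) = 8 * r ^ 3 * s ^ 3 := by
  have : 4 * r ^ 2 * s ^ 2 + c * 0 ^ 2 = (2 * r * s) ^ (2 : ℝ) := by
    rw [Real.rpow_two]
    ring
  rw [this, ← Real.rpow_mul (by positivity)]
  norm_num
  ring

lemma f_zero {r : ℝ} (hr : 0 < r) : f N r 0 = gamma N / (2 * r ^ 3) := by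
  rw [f, gamma, mul_div_assoc, ← mul_div_right_comm, one_mul, Finset.sum_div, Finset.sum_div]
  refine Finset.sum_congr rfl fun k hk => ?_
  have hs := sin_pos_of_mem_Icc hk
  rw [rpow_three_halves hr hs]
  field_simp
  norm_num

lemma g_zero {r : ℝ} (hr : 0 < r) : g N r 0 = 2 * alpha N / r ^ 3 := by
  rw [g, alpha, ← mul_assoc, Finset.mul_sum, Finset.sum_div]
  refine Finset.sum_congr rfl fun k hk => ?_
  have hs := sin_pos_of_mem_Icc hk
  rw [rpow_three_halves hr hs]
  field_simp
  ring

lemma F_zero (m a : ℝ) {r : ℝ} (hr : 0 < r) :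
    F N m a r 0 = a ^ 2 / r ^ 3 - m * gamma N / r ^ 2 := by
  rw [F, f_zero hr]
  field_simp

lemma F_neg (m a r d : ℝ) : F N m a r (-d) = F N m a r d := by simp [F, f]

lemma G_neg (m r d : ℝ) : G N m r (-d) = -G N m r d := by simp [G, g]; ring

section Smooth

variable {E : Type*} [NormedAddCommGroup E] [NormedSpace ℝ E] {a r d : E → ℝ} {x : E}

lemma contDiffAt_separation_rpow (hr : ContDiffAt ℝ 1 r x) (hd : ContDiffAt ℝ 1 d x)
    (hpos : 0 < r x) {k : ℕ} (hk : k ∈ Finset.Icc 1 (2 * N - 1)) :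
    ContDiffAt ℝ 1 (fun x => (4 * r x ^ 2 * Real.sin (k * Real.pi / (2 * N)) ^ 2
      + ((-1) ^ k - 1) ^ 2 * d x ^ 2) ^ (3 / 2 : ℝ)) x :=
  ContDiffAt.rpow_const_of_ne (by fun_prop) (separation_pos hk hpos _).ne'

lemma contDiffAt_f (hr : ContDiffAt ℝ 1 r x) (hd : ContDiffAt ℝ 1 d x) (hpos : 0 < r x) :
    ContDiffAt ℝ 1 (fun x => f N (r x) (d x)) x :=
  ContDiffAt.sum fun _ hk => contDiffAt_const.div (contDiffAt_separation_rpow hr hd hpos hk)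
    (Real.rpow_pos_of_pos (separation_pos hk hpos _) _).ne'

lemma contDiffAt_g (hr : ContDiffAt ℝ 1 r x) (hd : ContDiffAt ℝ 1 d x) (hpos : 0 < r x) :
    ContDiffAt ℝ 1 (fun x => g N (r x) (d x)) x :=
  ContDiffAt.sum fun _ hk => contDiffAt_const.div (contDiffAt_separation_rpow hr hd hpos hk)
    (Real.rpow_pos_of_pos (separation_pos hk hpos _) _).ne'

lemma contDiffAt_F (m : ℝ) (ha : ContDiffAt ℝ 1 a x) (hr : ContDiffAt ℝ 1 r x)
    (hd : ContDiffAt ℝ 1 d x) (hpos : 0 < r x) :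
    ContDiffAt ℝ 1 (fun x => F N m (a x) (r x) (d x)) x :=
  ((ha.pow 2).div (hr.pow 3) (by positivity)).sub
    (((contDiffAt_const.mul hr).mul contDiffAt_const).mul (contDiffAt_f hr hd hpos))

lemma contDiffAt_G (m : ℝ) (hr : ContDiffAt ℝ 1 r x) (hd : ContDiffAt ℝ 1 d x) (hpos : 0 < r x) :
    ContDiffAt ℝ 1 (fun x => G N m (r x) (d x)) x :=
  (((contDiffAt_const.mul hd).div_const 2).neg).mul (contDiffAt_g hr hd hpos)

end Smooth

/-! ### Uniqueness of solutions -/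

/-- The vector field of the equations of motion in the phase variables `(r, r', d, d')`. -/
def vectorField (N : ℕ) (m a : ℝ) (x : ℝ × ℝ × ℝ × ℝ) : ℝ × ℝ × ℝ × ℝ :=
  (x.2.1, F N m a x.1 x.2.2.1, x.2.2.2, G N m x.1 x.2.2.1)

lemma contDiffAt_vectorField (m a : ℝ) {x : ℝ × ℝ × ℝ × ℝ} (hx : 0 < x.1) :
    ContDiffAt ℝ 1 (vectorField N m a) x :=
  ContDiffAt.prodMk (by fun_prop) <| ContDiffAt.prodMk
    (contDiffAt_F m contDiffAt_const (by fun_prop) (by fun_prop) hx) <|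
    ContDiffAt.prodMk (by fun_prop) (contDiffAt_G m (by fun_prop) (by fun_prop) hx)

/-- The phase curve of a pair of functions. -/
def phase (r d : ℝ → ℝ) (t : ℝ) : ℝ × ℝ × ℝ × ℝ := (r t, deriv r t, d t, deriv d t)

lemma IsSolution.hasDerivAt_phase {m r₀ a b : ℝ} {r d : ℝ → ℝ} (h : IsSolution N m r₀ a b r d)
    (t : ℝ) : HasDerivAt (phase r d) (vectorField N m a (phase r d t)) t :=
  (h.differentiable_r t).hasDerivAt.prodMk <| (h.eq_r t).prodMk <|
    (h.differentiable_d t).hasDerivAt.prodMk (h.eq_d t)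

/-- The vector field is only locally Lipschitz, so local uniqueness is combined with the
connectedness of the time axis. -/
lemma IsSolution.unique {m r₀ a b : ℝ} {r d r' d' : ℝ → ℝ} (h : IsSolution N m r₀ a b r d)
    (h' : IsSolution N m r₀ a b r' d') : r' = r ∧ d' = d := by
  have hc : Continuous (phase r d) :=
    continuous_iff_continuousAt.2 fun t => (h.hasDerivAt_phase t).continuousAt
  have hc' : Continuous (phase r' d') :=
    continuous_iff_continuousAt.2 fun t => (h'.hasDerivAt_phase t).continuousAt
  have hclopen : IsClopen {t | phase r' d' t = phase r d t} := by
    refine ⟨isClosed_eq hc' hc, isOpen_iff_mem_nhds.2 fun t ht => ?_⟩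
    obtain ⟨K, s, hs, hK⟩ := (contDiffAt_vectorField (N := N) m a (x := phase r d t)
      (h.pos t)).exists_lipschitzOnWith
    refine ODE_solution_unique_of_eventually (v := fun _ => vectorField N m a)
      (s := fun _ => s) (Eventually.of_forall fun _ => hK) ?_ ?_ ht
    · exact (Eventually.of_forall h'.hasDerivAt_phase).and
        (hc'.continuousAt.eventually (by rw [ht]; exact hs))
    · exact (Eventually.of_forall h.hasDerivAt_phase).and (hc.continuousAt.eventually hs)
  have huniv := hclopen.eq_univ ⟨0, by
    simp [phase, h.r_zero, h'.r_zero, h.deriv_r_zero, h'.deriv_r_zero, h.d_zero, h'.d_zero,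
      h.deriv_d_zero, h'.deriv_d_zero]⟩
  have key (t : ℝ) : phase r' d' t = phase r d t := Set.eq_univ_iff_forall.1 huniv t
  exact ⟨funext fun t => congrArg (·.1) (key t), funext fun t => congrArg (·.2.2.1) (key t)⟩

end HipHop

/-! ### Comparison of the radial and vertical frequencies -/

namespace HipHop

open Filter Topology

variable {N : ℕ}

lemma sin_first_le {k : ℕ} (hk : k ∈ Finset.Icc 1 (2 * N - 1)) :
    Real.sin (Real.pi / (2 * N)) ≤ Real.sin (k * Real.pi / (2 * N)) := by
  rw [Finset.mem_Icc] at hk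
  have hN : (1 : ℝ) ≤ N := by exact_mod_cast (by omega : 1 ≤ N)
  have h1 : (1 : ℝ) ≤ k := by exact_mod_cast hk.1
  have h2 : (k : ℝ) + 1 ≤ 2 * N := by exact_mod_cast (by omega : k + 1 ≤ 2 * N)
  have hπ := Real.pi_pos
  have hθ : 0 < Real.pi / (2 * N) := by positivity
  have hθN : 2 * N * (Real.pi / (2 * N)) = Real.pi := by field_simp
  rw [mul_div_assoc]
  set θ := Real.pi / (2 * N)
  rcases le_total (k : ℝ) N with h | h
  · exact Real.sin_le_sin_of_le_of_le_pi_div_two (by linarith) (by nlinarith) (by nlinarith)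
  · rw [← Real.sin_pi_sub (k * θ)]
    exact Real.sin_le_sin_of_le_of_le_pi_div_two (by linarith) (by nlinarith) (by nlinarith)

lemma gamma_pos (hN : 1 < N) : 0 < gamma N := by
  refine mul_pos (by norm_num) (Finset.sum_pos (fun k hk => ?_) ?_)
  · have := sin_pos_of_mem_Icc hk
    positivity
  · exact Finset.nonempty_Icc.2 (by omega)

/-- Keeping only the terms `k = 1` and `k = 2N - 1`. -/
lemma le_alpha (hN : 1 < N) : 1 / (2 * Real.sin (Real.pi / (2 * N)) ^ 3) ≤ alpha N := by
  set t : ℕ → ℝ := fun k => ((-1) ^ k - 1) ^ 2 / Real.sin (k * Real.pi / (2 * N)) ^ 3 with ht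
  have hN0 : (N : ℝ) ≠ 0 := by
    have : N ≠ 0 := by omega
    exact_mod_cast this
  have hsub : ({1, 2 * N - 1} : Finset ℕ) ⊆ Finset.Icc 1 (2 * N - 1) := by
    intro k hk
    simp only [Finset.mem_insert, Finset.mem_singleton] at hk
    rw [Finset.mem_Icc]
    omega
  have hsum := Finset.sum_le_sum_of_subset_of_nonneg (f := t) hsub fun k hk _ => by
    have := sin_pos_of_mem_Icc hk
    simp only [ht]
    positivity
  rw [Finset.sum_pair (by omega)] at hsum
  have h1 : t 1 = 4 / Real.sin (Real.pi / (2 * N)) ^ 3 := by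
    simp [ht]
    norm_num
  have h2 : t (2 * N - 1) = 4 / Real.sin (Real.pi / (2 * N)) ^ 3 := by
    have ho : Odd (2 * N - 1) := ⟨N - 1, by omega⟩
    have hcast : ((2 * N - 1 : ℕ) : ℝ) = 2 * N - 1 := by
      rw [Nat.cast_sub (by omega)]
      simp
    have hs : ((2 * N - 1 : ℕ) : ℝ) * Real.pi / (2 * N) = Real.pi - Real.pi / (2 * N) := by
      rw [hcast]
      field_simp
    simp only [ht, ho.neg_one_pow, hs, Real.sin_pi_sub]
    norm_num
  rw [h1, h2] at hsum
  calc _ = 1 / 16 * (4 / Real.sin (Real.pi / (2 * N)) ^ 3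
        + 4 / Real.sin (Real.pi / (2 * N)) ^ 3) := by
        ring
    _ ≤ alpha N := by
      rw [alpha]
      gcongr

/-- Bounding every term by the first one. -/
lemma gamma_le (hN : 1 < N) : gamma N ≤ (2 * N - 1) / (4 * Real.sin (Real.pi / (2 * N))) := by
  have h1 : 1 ∈ Finset.Icc 1 (2 * N - 1) := Finset.mem_Icc.2 (by omega)
  have hs : 0 < Real.sin (Real.pi / (2 * N)) := by simpa using sin_pos_of_mem_Icc h1
  have := Finset.sum_le_card_nsmul (Finset.Icc 1 (2 * N - 1))
    (fun k => 1 / Real.sin (k * Real.pi / (2 * N))) (1 / Real.sin (Real.pi / (2 * N)))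
    fun k hk => one_div_le_one_div_of_le hs (sin_first_le hk)
  rw [Nat.card_Icc, nsmul_eq_mul, Nat.add_sub_cancel, Nat.cast_sub (by omega)] at this
  push_cast at this
  calc gamma N ≤ 1 / 4 * ((2 * N - 1) * (1 / Real.sin (Real.pi / (2 * N)))) := by
        rw [gamma]
        gcongr
    _ = _ := by field_simp

/-- The radial frequency at the circular solution is smaller than the vertical one. This excludes
the resonance of the two. -/
lemma gamma_lt_alpha (hN : 1 < N) : gamma N < alpha N := by
  have h1 : 1 ∈ Finset.Icc 1 (2 * N - 1) := Finset.mem_Icc.2 (by omega)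
  have hs : 0 < Real.sin (Real.pi / (2 * N)) := by simpa using sin_pos_of_mem_Icc h1
  have hN' : (2 : ℝ) ≤ N := by exact_mod_cast hN
  have hπ := Real.pi_pos
  have hlt : Real.sin (Real.pi / (2 * N)) < Real.pi / (2 * N) := Real.sin_lt (by positivity)
  refine (gamma_le hN).trans_lt (lt_of_lt_of_le ?_ (le_alpha hN))
  have hπ2 : Real.pi ^ 2 < 10 - 1 / 8 := by nlinarith [Real.pi_lt_d4]
  have hsq : Real.sin (Real.pi / (2 * N)) ^ 2 < 2 / (2 * N - 1) := by
    calc _ < (Real.pi / (2 * N)) ^ 2 := by gcongr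
      _ ≤ 2 / (2 * N - 1) := by
        rw [div_pow, div_le_div_iff₀ (by positivity) (by linarith)]
        nlinarith
  rw [lt_div_iff₀ (by linarith)] at hsq
  rw [div_lt_div_iff₀ (by positivity) (by positivity)]
  nlinarith

/-! ### The cutoff of the radius -/

/-- A smooth bump function equal to `1` for radii near `r₀` and supported away from `0`. -/
def radiusBump {r₀ : ℝ} (hr₀ : 0 < r₀) : ContDiffBump r₀ :=
  ⟨r₀ / 4, r₀ / 2, by positivity, by linarith⟩

/-- A smooth positive function of the radius which is the identity near `r₀`. Composing the forces
with it makes them smooth everywhere without changing them near the circular solution. -/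
def cutoff {r₀ : ℝ} (hr₀ : 0 < r₀) (r : ℝ) : ℝ := r₀ + (r - r₀) * radiusBump hr₀ r

lemma contDiff_cutoff {r₀ : ℝ} (hr₀ : 0 < r₀) : ContDiff ℝ 1 (cutoff hr₀) :=
  contDiff_const.add ((contDiff_id.sub contDiff_const).mul (radiusBump hr₀).contDiff)

lemma cutoff_pos {r₀ : ℝ} (hr₀ : 0 < r₀) (r : ℝ) : 0 < cutoff hr₀ r := by
  have h0 := (radiusBump hr₀).nonneg (x := r)
  have h1 := (radiusBump hr₀).le_one (x := r)
  rw [cutoff]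
  by_cases h : r₀ / 2 ≤ |r - r₀|
  · rw [(radiusBump hr₀).zero_of_le_dist h]
    linarith
  · rw [not_le, abs_lt] at h
    nlinarith

lemma cutoff_eq {r₀ r : ℝ} (hr₀ : 0 < r₀) (h : |r - r₀| < r₀ / 4) : cutoff hr₀ r = r := by
  rw [cutoff, (radiusBump hr₀).one_of_mem_closedBall (Metric.mem_closedBall.2 h.le)]
  ring

/-! ### Global solutions -/

/-- An arc joining two symmetric configurations extends by reflections to a periodic solution. -/
lemma IsArc.exists_isSolution {P : ℝ × ℝ × ℝ → ℝ} {H : ℝ × ℝ → ℝ} {m r₀ a b T : ℝ}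
    {r r' d d' : ℝ → ℝ} (h : IsArc P H r₀ a b T r r' d d') (hT : 0 < T)
    (hpos : ∀ t ∈ Set.Icc 0 T, 0 < r t)
    (hP : ∀ t ∈ Set.Icc 0 T, P (a, r t, d t) = F N m a (r t) (d t))
    (hH : ∀ t ∈ Set.Icc 0 T, d t * H (r t, d t) = G N m (r t) (d t)) :
    ∃ R D : ℝ → ℝ, IsSolution N m r₀ a b R D ∧ Function.Periodic R (2 * T) ∧
      Function.Periodic D (2 * T) ∧ SystemII R D T := by
  have m0 : (0 : ℝ) ∈ Set.Icc 0 T := ⟨le_rfl, hT.le⟩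
  have mT : T ∈ Set.Icc 0 T := ⟨hT.le, le_rfl⟩
  have e0 := h.d_zero
  have eT := h.d_end
  have f0 := h.r'_zero
  have fT := h.r'_end
  have G0 (x : ℝ) : G N m x 0 = 0 := by simp [G]
  have dr := hasDerivAt_reflectExtend (σ := 1) hT h.hasDerivAt_r (by simp) (by simp)
    (by simp [f0]) (by simp [fT])
  have dr' := hasDerivAt_reflectExtend (σ := -1) (q := fun t => F N m a (r t) (d t)) hT
    (fun t ht => (h.hasDerivAt_r' t ht).congr_deriv (hP t ht)) (by simp [f0]) (by simp [fT])
    (by simp) (by simp)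
  have dd := hasDerivAt_reflectExtend (σ := -1) hT h.hasDerivAt_d (by simp [e0]) (by simp [eT])
    (by simp) (by simp)
  have dd' := hasDerivAt_reflectExtend (σ := 1) (q := fun t => G N m (r t) (d t)) hT
    (fun t ht => (h.hasDerivAt_d' t ht).congr_deriv (hH t ht)) (by simp) (by simp)
    (by simp [e0, G0]) (by simp [eT, G0])
  rw [neg_neg] at dr' dd
  have er : deriv (reflectExtend 1 T r) = reflectExtend (-1) T r' := funext fun t => (dr t).deriv
  have ed : deriv (reflectExtend (-1) T d) = reflectExtend 1 T d' := funext fun t => (dd t).deriv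
  refine ⟨reflectExtend 1 T r, reflectExtend (-1) T d,
    ⟨fun t => ?_, fun t => (dr t).differentiableAt, fun t => (dd t).differentiableAt,
      fun t => ?_, fun t => ?_, ?_, ?_, ?_, ?_⟩,
    reflectExtend_periodic hT, reflectExtend_periodic hT, hT, ?_, ?_⟩
  · obtain ⟨s, hs, e | e⟩ := exists_reflectExtend_eq hT t
    · rw [e]; exact hpos s hs
    · rw [e, one_mul]; exact hpos s hs
  · rw [er]
    refine (dr' t).congr_deriv ?_
    obtain ⟨s, -, e | e⟩ := exists_reflectExtend_eq hT t
    · simp only [e]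
    · simp only [e, one_mul, neg_one_mul, F_neg]
  · rw [ed]
    refine (dd' t).congr_deriv ?_
    obtain ⟨s, -, e | e⟩ := exists_reflectExtend_eq hT t
    · simp only [e]
    · simp only [e, one_mul, neg_one_mul, G_neg]
  · rw [reflectExtend_of_mem hT (by simp) (by simp) m0, h.r_zero]
  · rw [er, reflectExtend_of_mem hT (by simp [f0]) (by simp [fT]) m0, f0]
  · rw [reflectExtend_of_mem hT (by simp [e0]) (by simp [eT]) m0, e0]
  · rw [ed, reflectExtend_of_mem hT (by simp) (by simp) m0, h.d'_zero]
  · rw [er, reflectExtend_of_mem hT (by simp [f0]) (by simp [fT]) mT, fT]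
  · rw [reflectExtend_of_mem hT (by simp [e0]) (by simp [eT]) mT, eT]

/-- The linearization of the radial force at the circular solution. -/
lemma fderiv_radial_apply {m r₀ : ℝ} (hr₀ : 0 < r₀) (hmγ : 0 ≤ m * gamma N * r₀)
    (hP : ContDiff ℝ 1 fun v : ℝ × ℝ × ℝ => F N m v.1 (cutoff hr₀ v.2.1) v.2.2) (p x : ℝ) :
    fderiv ℝ (fun v : ℝ × ℝ × ℝ => F N m v.1 (cutoff hr₀ v.2.1) v.2.2)
        (Real.sqrt (m * gamma N * r₀), r₀, 0) (p, x, 0)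
      = 2 * Real.sqrt (m * gamma N * r₀) / r₀ ^ 3 * p
        - Real.sqrt (m * gamma N / r₀ ^ 3) ^ 2 * x := by
  have hsq : Real.sqrt (m * gamma N / r₀ ^ 3) ^ 2 = m * gamma N / r₀ ^ 3 :=
    Real.sq_sqrt (div_nonneg (nonneg_of_mul_nonneg_left hmγ hr₀) (by positivity))
  have ha : Real.sqrt (m * gamma N * r₀) ^ 2 = m * gamma N * r₀ := Real.sq_sqrt hmγ
  rw [hsq]
  set a₀ := Real.sqrt (m * gamma N * r₀)
  refine fderiv_apply_eq_of_hasDerivAt_line (hP.differentiable one_ne_zero _) ?_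
  have hl := hasDerivAt_affine r₀ x
  have h1 := ((hasDerivAt_affine a₀ p).pow 2).div (hl.pow 3) (by simpa using hr₀.ne')
  have h2 := (hasDerivAt_const (0 : ℝ) (m * gamma N)).div (hl.pow 2) (by simpa using hr₀.ne')
  have hnear : ∀ᶠ t in 𝓝 (0 : ℝ), |r₀ + t * x - r₀| < r₀ / 4 :=
    (hl.continuousAt.sub continuousAt_const).abs.eventually (gt_mem_nhds (by simpa using hr₀))
  refine ((h1.sub h2).congr_deriv ?_).congr_of_eventuallyEq ?_
  · simp
    field_simp
    linear_combination (-3 * x) * ha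
  · filter_upwards [hnear] with t ht
    have hpos : 0 < r₀ + t * x := by
      rw [abs_lt] at ht
      linarith
    simp [cutoff_eq hr₀ ht, F_zero m _ hpos]

end HipHop

end

theorem theorem2 (N : ℕ) (hN : 1 < N) (m r₀ : ℝ) (hm : 0 < m) (hr₀ : 0 < r₀) :
    ∃ (bhat : ℝ) (T a : ℝ → ℝ), 0 < bhat ∧
      ContDiffOn ℝ 1 T (Set.Ioo (-bhat) bhat) ∧
      ContDiffOn ℝ 1 a (Set.Ioo (-bhat) bhat) ∧
      T 0 = Real.pi * Real.sqrt (r₀ ^ 3 / (m * HipHop.alpha N)) ∧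
      a 0 = Real.sqrt (m * HipHop.gamma N * r₀) ∧
      ∀ b ∈ Set.Ioo (-bhat) bhat, ∃ r d : ℝ → ℝ,
        HipHop.IsSolution N m r₀ (a b) b r d ∧
        (∀ r' d' : ℝ → ℝ, HipHop.IsSolution N m r₀ (a b) b r' d' → r' = r ∧ d' = d) ∧
        Function.Periodic r (2 * T b) ∧ Function.Periodic d (2 * T b) ∧
        HipHop.SystemII r d (T b) := by
  open HipHop in
  have hγ := gamma_pos hN
  have hγα := gamma_lt_alpha hN
  have hα := hγ.trans hγα
  have hπ := Real.pi_pos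
  have hP : ContDiff ℝ 1 fun v : ℝ × ℝ × ℝ => F N m v.1 (cutoff hr₀ v.2.1) v.2.2 :=
    contDiff_iff_contDiffAt.2 fun v => contDiffAt_F m (by fun_prop)
      ((contDiff_cutoff hr₀).contDiffAt.comp v (by fun_prop)) (by fun_prop) (cutoff_pos hr₀ _)
  have hH : ContDiff ℝ 1 fun v : ℝ × ℝ => -(m / 2) * g N (cutoff hr₀ v.1) v.2 :=
    contDiff_iff_contDiffAt.2 fun v => contDiffAt_const.mul (contDiffAt_g
      ((contDiff_cutoff hr₀).contDiffAt.comp v (by fun_prop)) (by fun_prop) (cutoff_pos hr₀ _))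
  have hcut : cutoff hr₀ r₀ = r₀ := cutoff_eq hr₀ (by simpa using hr₀)
  set ν := Real.sqrt (m * gamma N / r₀ ^ 3) with hν
  set ω := Real.sqrt (m * alpha N / r₀ ^ 3) with hω
  have hν0 : 0 < ν := Real.sqrt_pos.2 (by positivity)
  have hω0 : 0 < ω := Real.sqrt_pos.2 (by positivity)
  have hνω : ν < ω := Real.sqrt_lt_sqrt (by positivity) (by gcongr)
  obtain ⟨δ, T, a, hδ, hT, ha, hT0, ha0, hsol⟩ := exists_isArc_family hP hH (r₀ := r₀)
    (a₀ := Real.sqrt (m * gamma N * r₀)) (κ := 2 * Real.sqrt (m * gamma N * r₀) / r₀ ^ 3)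
    (ν := ν) (ω := ω) (ε := r₀ / 4)
    (by
      simp only [hcut]
      rw [F_zero m _ hr₀, Real.sq_sqrt (by positivity)]
      field_simp
      ring)
    (fderiv_radial_apply hr₀ (by positivity) hP)
    (by
      simp only [hcut]
      rw [g_zero hr₀, hω, Real.sq_sqrt (by positivity)]
      field_simp)
    (by positivity) hν0.ne' hω0
    (by
      -- `0 < π ν / ω < π` because the radial frequency is the smaller one
      refine (Real.sin_pos_of_pos_of_lt_pi (by positivity) ?_).ne'
      rw [div_mul_eq_mul_div, div_lt_iff₀ hω0]
      gcongr)
    (by positivity)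
  refine ⟨δ, T, a, hδ, hT, ha, ?_, ha0, fun b hb => ?_⟩
  · rw [hT0, hω, ← inv_div (m * alpha N), Real.sqrt_inv, div_eq_mul_inv]
  · obtain ⟨hTb, r, r', d, d', harc, hr⟩ := hsol b hb
    obtain ⟨R, D, hRD, hpR, hpD, hII⟩ := harc.exists_isSolution (N := N) (m := m) hTb
      (fun t ht => by linarith [(abs_lt.1 (hr t ht)).1])
      (fun t ht => by simp only [cutoff_eq hr₀ (hr t ht)])
      (fun t ht => by simp only [cutoff_eq hr₀ (hr t ht), G]; ring)
    exact ⟨R, D, hRD, fun _ _ h => hRD.unique h, hpR, hpD, hII⟩
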